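/- Regard an integer partition $\mu$ as a weakly decreasing infinite sequence $\mu_1\ge\mu_2\ge\cdots$ of nonnegative integers with finitely many nonzero terms, and identify it with its Ferrers board (left-justified rows of $\mu_1,\mu_2,\dots$ boxes). A partition $\alpha$ \emph{contains} $\mu$ if some rows and columns can be deleted from the Ferrers board of $\alpha$ so that, after top/left justifying the remaining boxes, one obtains the Ferrers board of $\mu$; otherwise $\alpha$ \emph{avoids} $\mu$. Let $\mathrm{Av}_n(\mu)$ be the set of partitions of $n$ that avoid $\mu$. Call $\mu$ \emph{strict} if its positive parts are pairwise distinct. \textbf{Corollary.} If $\mu$ is a strict partition with $\mu_1-\mu_2=1$ and $\mu_2>0$, then the generating function $$\sum_{n\ge 0}|\mathrm{Av}_n(\mu)|\,z^n\in\mathbb{Q}[[z]]$$ is not algebraic over $\mathbb{Q}(z)$. -/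

import Mathlib

/-!
Integer partitions are represented by their Ferrers boards, i.e. by Mathlib's `YoungDiagram`
(finite lower sets of `ℕ × ℕ`, with rows listed downwards from the top and columns from the left).
The parts `μ₁ ≥ μ₂ ≥ ⋯` (an infinite sequence, eventually zero) of the partition `μ` are
`μ.rowLen 0, μ.rowLen 1, …`, and its weight is `μ.card`.
-/

namespace PartitionPattern

/-- A partition is strict if its positive parts are distinct. -/
def IsStrict (μ : YoungDiagram) : Prop :=
  ∀ i j : ℕ, 0 < μ.rowLen i → μ.rowLen i = μ.rowLen j → i = j

/-- `α` contains `μ`: some rows and columns can be deleted from the board of `α` so that, after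
top/left justifying the remaining boxes, one obtains the board of `μ`.
The increasing maps `r` and `c` list, in order, the rows and the columns that are not deleted
(rows and columns of the quadrant outside the board are empty), so that justifying moves
the box in row `r i` and column `c j` to row `i` and column `j`. -/
def Contains (α μ : YoungDiagram) : Prop :=
  ∃ r c : ℕ → ℕ, StrictMono r ∧ StrictMono c ∧ ∀ i j : ℕ, (i, j) ∈ μ ↔ (r i, c j) ∈ α

/-- `Av n μ` is the set of all partitions of `n` that avoid `μ`. -/
def Av (n : ℕ) (μ : YoungDiagram) : Set YoungDiagram :=
  {α | α.card = n ∧ ¬ Contains α μ}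

/-- There are finitely many partitions of `n`, hence `(Av n μ).ncard` is a genuine count. -/
theorem finite_Av (n : ℕ) (μ : YoungDiagram) : (Av n μ).Finite := by
  refine Set.Finite.of_finite_image (f := YoungDiagram.cells) ?_
    (fun α _ β _ h => YoungDiagram.ext h)
  refine ((Finset.range n ×ˢ Finset.range n).powerset.finite_toSet).subset ?_
  rintro _ ⟨α, ⟨hα, -⟩, rfl⟩
  simp only [Finset.coe_powerset, Set.mem_preimage, Set.mem_powerset_iff, Finset.coe_subset]
  rintro ⟨i, j⟩ hij
  have hij' : (i, j) ∈ α := hij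
  have hi : α.colLen j ≤ n := by
    rw [YoungDiagram.colLen_eq_card, ← hα]
    exact Finset.card_le_card (Finset.filter_subset _ _)
  have hj : α.rowLen i ≤ n := by
    rw [YoungDiagram.rowLen_eq_card, ← hα]
    exact Finset.card_le_card (Finset.filter_subset _ _)
  have h1 := YoungDiagram.mem_iff_lt_colLen.1 hij'
  have h2 := YoungDiagram.mem_iff_lt_rowLen.1 hij'
  simp only [Finset.mem_product, Finset.mem_range]
  omega

/-- The generating function `∑ₙ |Avₙ(μ)| zⁿ`, as a formal power series over `ℚ`. -/
noncomputable def genFun (μ : YoungDiagram) : PowerSeries ℚ :=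
  PowerSeries.mk fun n => ((Av n μ).ncard : ℚ)

end PartitionPattern

/-!
Put `m = μ₂ = μ₁ - 1` and let `F` be the generating function. A partition avoiding the strict
partition `μ` has at most `m` distinct part sizes, so `F ≤ (1 + L) ^ m` on `[0, 1)`, where
`L = ∑ₛ xˢ / (1 - xˢ)` is the Lambert series of the divisor function; hence `(1 - x) ^ m * F` is
bounded by a polynomial in `log (1 / (1 - x))`. On the other hand every partition with arbitrary
parts smaller than `m` and a single further part size avoids `μ`, which bounds `F` below by
`∏ᵢ (1 - xⁱ)⁻¹` over `1 ≤ i < m` times a tail of `L`; hence `(1 - x) ^ m * F` tends to infinity as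
`x → 1`.

No algebraic function behaves like this: in a polynomial relation between `x` and
`y = (1 - x) ^ m * F`, cancel the common power of `x - 1` from the coefficients. Since every
`(1 - x) * y ^ j` tends to `0`, replacing `x` by `1` in the coefficients changes the relation by
`o(1)`, so a nonzero polynomial in `y` alone tends to `0` although `y → ∞`.
-/

namespace PartitionPattern

section Evaluation

open PowerSeries

variable (R : Type*) {A : Type*} [CommRing R] [NormedCommRing A] [Algebra R A] (a : A)

variable {R} in
theorem sum_antidiagonal_coeff_smul_mul (F G : R⟦X⟧) (n : ℕ) :
    ∑ p ∈ Finset.HasAntidiagonal.antidiagonal n, coeff p.1 F • a ^ p.1 * coeff p.2 G • a ^ p.2 =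
      coeff n (F * G) • a ^ n := by
  rw [coeff_mul, Finset.sum_smul]
  refine Finset.sum_congr rfl fun p hp ↦ ?_
  rw [smul_mul_smul_comm, ← pow_add, Finset.HasAntidiagonal.mem_antidiagonal.1 hp]

/-- The power series over `R` that converge absolutely at the point `a`. -/
def absConvergent : Subalgebra R R⟦X⟧ where
  carrier := {F | Summable fun n ↦ ‖coeff n F • a ^ n‖}
  mul_mem' {F G} hF hG := by
    simpa only [Set.mem_ofPred_eq, sum_antidiagonal_coeff_smul_mul] using
      summable_norm_sum_mul_antidiagonal_of_summable_norm hF hG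
  add_mem' {F G} hF hG := .of_nonneg_of_le (fun _ ↦ norm_nonneg _)
    (fun n ↦ by simpa only [map_add, add_smul] using norm_add_le _ _) (hF.add hG)
  algebraMap_mem' r := summable_of_hasFiniteSupport <|
    (Set.finite_singleton 0).subset fun n hn ↦ by
      by_contra h0
      simp_all [coeff_C]

variable {R a} in
theorem mem_absConvergent {F : R⟦X⟧} :
    F ∈ absConvergent R a ↔ Summable fun n ↦ ‖coeff n F • a ^ n‖ := Iff.rfl

theorem X_mem_absConvergent : (X : R⟦X⟧) ∈ absConvergent R a :=
  summable_of_hasFiniteSupport <| (Set.finite_singleton 1).subset fun n hn ↦ by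
    by_contra h1
    simp_all [coeff_X]

variable [CompleteSpace A]

/-- Evaluation at `a` of the power series that converge absolutely there. -/
noncomputable def evalHom : absConvergent R a →ₐ[R] A where
  toFun F := ∑' n, coeff n (F : R⟦X⟧) • a ^ n
  map_one' := by
    rw [tsum_eq_single 0 fun n hn ↦ by simp [coeff_one, hn]]
    simp
  map_mul' F G := by
    rw [tsum_mul_tsum_eq_tsum_sum_antidiagonal_of_summable_norm F.2 G.2]
    simp only [sum_antidiagonal_coeff_smul_mul, Subalgebra.coe_mul]
  map_zero' := by simp
  map_add' F G := by
    simp only [Subalgebra.coe_add, map_add, add_smul]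
    exact F.2.of_norm.tsum_add G.2.of_norm
  commutes' r := by
    rw [tsum_eq_single 0 fun n hn ↦ by simp [coeff_C, hn]]
    simp [Algebra.smul_def]

theorem evalHom_apply (F : absConvergent R a) :
    evalHom R a F = ∑' n, coeff n (F : R⟦X⟧) • a ^ n := rfl

variable {R}

theorem evalHom_X : evalHom R a ⟨X, X_mem_absConvergent R a⟩ = a := by
  rw [evalHom_apply, tsum_eq_single 1 fun n hn ↦ by simp [coeff_X, hn]]
  simp

theorem aevalAeval_evalHom_eq_zero (F : absConvergent R a) {P : Polynomial (Polynomial R)}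
    (hP : Polynomial.aeval (F : R⟦X⟧) P = 0) : P.aevalAeval a (evalHom R a F) = 0 := by
  let x : absConvergent R a := ⟨X, X_mem_absConvergent R a⟩
  have val_comp : (absConvergent R a).val.comp (Polynomial.aevalAeval x F) =
      (Polynomial.aeval (F : R⟦X⟧)).restrictScalars R := by
    apply Polynomial.algHom_ext' <;> [ext1; skip] <;> simp [x, PowerSeries.algebraMap_apply']
  have evalHom_comp : (evalHom R a).comp (Polynomial.aevalAeval x F) =
      Polynomial.aevalAeval a (evalHom R a F) := by
    apply Polynomial.algHom_ext' <;> [ext1; skip] <;> simp [x, evalHom_X]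
  have hP' : P.aevalAeval x F = 0 := Subtype.val_injective ((congr($val_comp P)).trans hP)
  rw [← evalHom_comp, AlgHom.comp_apply, hP', map_zero]

end Evaluation

section GrowthCriterion

open Polynomial Filter Topology

theorem exists_eq_C_X_sub_C_pow_mul {R : Type*} [CommRing R] [IsDomain R] [IsNoetherianRing R]
    {P : R[X][X]} (hP : P ≠ 0) (x₀ : R) :
    ∃ (k : ℕ) (Q : R[X][X]), P = C ((X - C x₀) ^ k) * Q ∧ Q.map (evalRingHom x₀) ≠ 0 := by
  obtain ⟨Q, hPQ, hQ⟩ := (FiniteMultiplicity.of_not_isUnit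
    (mt isUnit_C.1 (not_isUnit_X_sub_C x₀)) hP).exists_eq_pow_mul_and_not_dvd
  refine ⟨_, Q, by rwa [← C_pow] at hPQ, fun h ↦ hQ <| C_dvd_iff_dvd_coeff _ _ |>.2 fun i ↦ ?_⟩
  rw [dvd_iff_isRoot, IsRoot, ← coe_evalRingHom, ← coeff_map, h, coeff_zero]

variable {ι : Type*} {l : Filter ι} {x y : ι → ℝ} {x₀ : ℝ}

theorem tendsto_evalEval_sub_evalEval (h : ∀ j, Tendsto (fun i ↦ (x i - x₀) * y i ^ j) l (𝓝 0))
    (P : ℝ[X][X]) :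
    Tendsto (fun i ↦ P.evalEval (x i) (y i) - P.evalEval x₀ (y i)) l (𝓝 0) := by
  induction P using Polynomial.induction_on' with
  | add P Q hP hQ => simpa [evalEval_add, add_sub_add_comm] using hP.add hQ
  | monomial j p =>
    obtain ⟨q, hq⟩ := X_sub_C_dvd_sub_C_eval (p := p) (a := x₀)
    have hx : Tendsto x l (𝓝 x₀) := by simpa using (h 0).add_const x₀
    have hqx := (q.continuous.tendsto x₀).comp hx
    have eval_sub (t : ℝ) : p.eval t - p.eval x₀ = (t - x₀) * q.eval t := by
      simpa using congr(eval t $hq)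
    simpa [evalEval, ← sub_mul, eval_sub, mul_assoc, mul_left_comm] using hqx.mul (h j)

theorem not_eventually_evalEval_eq_zero [l.NeBot] {P : ℝ[X][X]} (hP : P ≠ 0)
    (hx : ∀ᶠ i in l, x i ≠ x₀) (hy : Tendsto y l atTop)
    (h : ∀ j, Tendsto (fun i ↦ (x i - x₀) * y i ^ j) l (𝓝 0)) :
    ¬ ∀ᶠ i in l, P.evalEval (x i) (y i) = 0 := by
  intro hzero
  obtain ⟨k, Q, rfl, hQ⟩ := exists_eq_C_X_sub_C_pow_mul hP x₀
  have hQ0 : Tendsto (fun i ↦ (Q.map (evalRingHom x₀)).eval (y i)) l (𝓝 0) := by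
    refine (neg_zero (G := ℝ) ▸ (tendsto_evalEval_sub_evalEval h Q).neg).congr' ?_
    filter_upwards [hzero, hx] with i hi hxi
    have : Q.evalEval (x i) (y i) = 0 := by
      simpa [evalEval_mul, evalEval_C, sub_eq_zero, hxi] using hi
    rw [this, zero_sub, neg_neg, map_evalRingHom_eval]
  have one_isBigO := (isBigO_atTop_of_degree_le (C (1 : ℝ)) (Q.map (evalRingHom x₀))
    (degree_C_le.trans (zero_le_degree_iff.2 hQ))).comp_tendsto hy
  have one_tendsto_zero : Tendsto (fun _ ↦ (1 : ℝ)) l (𝓝 0) := by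
    simpa only [eval_C, Function.comp_def] using one_isBigO.trans_tendsto hQ0
  exact one_ne_zero (tendsto_nhds_unique tendsto_const_nhds one_tendsto_zero)

theorem tendsto_one_sub_mul_eval_neg_log_pow (p : ℝ[X]) (j : ℕ) :
    Tendsto (fun x : ℝ ↦ (1 - x) * p.eval (-Real.log (1 - x)) ^ j) (𝓝[<] 1) (𝓝 0) := by
  have one_sub : Tendsto (fun x : ℝ ↦ 1 - x) (𝓝[<] 1) (𝓝[>] 0) := by
    refine tendsto_nhdsWithin_iff.2 ⟨?_, ?_⟩
    · refine Tendsto.mono_left ?_ nhdsWithin_le_nhds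
      simpa using (continuous_sub_left (1 : ℝ)).tendsto 1
    · filter_upwards [self_mem_nhdsWithin] with x hx using sub_pos.2 (Set.mem_Iio.1 hx)
  have neg_log := tendsto_neg_atBot_atTop.comp (Real.tendsto_log_nhdsGT_zero.comp one_sub)
  refine ((p ^ j).tendsto_div_exp_atTop.comp neg_log).congr' ?_
  filter_upwards [self_mem_nhdsWithin] with x hx
  simp [Real.exp_neg, Real.exp_log (sub_pos.2 hx), mul_comm]

theorem tendsto_one_sub_mul_pow_of_le_log {y : ℝ → ℝ} {p : ℝ[X]} (hy : ∀ᶠ x in 𝓝[<] 1, 0 ≤ y x)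
    (hyp : ∀ᶠ x in 𝓝[<] 1, y x ≤ p.eval (-Real.log (1 - x))) (j : ℕ) :
    Tendsto (fun x ↦ (1 - x) * y x ^ j) (𝓝[<] 1) (𝓝 0) := by
  refine tendsto_of_tendsto_of_tendsto_of_le_of_le' tendsto_const_nhds
    (tendsto_one_sub_mul_eval_neg_log_pow p j) ?_ ?_
  all_goals filter_upwards [self_mem_nhdsWithin, hy, hyp] with x (hx : x < 1) h0 hp
  · exact mul_nonneg (sub_pos.2 hx).le (pow_nonneg h0 j)
  · gcongr

theorem evalEval_map_algebraMap {R A : Type*} [CommRing R] [CommRing A] [Algebra R A]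
    (P : R[X][X]) (x y : A) :
    (P.map (mapRingHom (algebraMap R A))).evalEval x y = P.aevalAeval x y := by
  have hom_eq : (evalEvalRingHom x y).comp (mapRingHom (mapRingHom (algebraMap R A))) =
      ((Polynomial.aevalAeval x y : R[X][X] →ₐ[R] A) : R[X][X] →+* A) := by
    ext <;> simp
  exact congr($hom_eq P)

variable {R : Type*} [CommRing R] [Algebra R ℝ] [FaithfulSMul R ℝ]

theorem transcendental_of_tendsto_atTop_of_le_log {F : PowerSeries R} {f : ℝ → ℝ} {m : ℕ}
    {p : ℝ[X]}
    (hF : ∀ᶠ x in 𝓝[<] 1, ∃ h : F ∈ absConvergent R x, evalHom R x ⟨F, h⟩ = f x)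
    (hf : Tendsto (fun x ↦ (1 - x) ^ m * f x) (𝓝[<] 1) atTop)
    (hp : ∀ᶠ x in 𝓝[<] 1, (1 - x) ^ m * f x ≤ p.eval (-Real.log (1 - x))) :
    Transcendental R[X] F := by
  intro hF_alg
  have hinj := FaithfulSMul.algebraMap_injective R ℝ
  have := hinj.isDomain (algebraMap R ℝ)
  obtain ⟨P, hP, hPF⟩ := (isAlgebraic_algebraMap ((1 - X : R[X]) ^ m)).mul hF_alg
  have hP' : P.map (mapRingHom (algebraMap R ℝ)) ≠ 0 :=
    (Polynomial.map_ne_zero_iff (map_injective _ hinj)).2 hP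
  have ne_one : ∀ᶠ x in 𝓝[<] (1 : ℝ), id x ≠ 1 :=
    eventually_mem_nhdsWithin.mono fun x hx ↦ (Set.mem_Iio.1 hx).ne
  refine not_eventually_evalEval_eq_zero hP' ne_one hf (fun j ↦ ?_) ?_
  · simpa only [id, ← neg_mul, neg_sub, neg_zero] using
      (tendsto_one_sub_mul_pow_of_le_log (hf.eventually_ge_atTop 0) hp j).neg
  · filter_upwards [hF] with x ⟨hx, hfx⟩
    let G : absConvergent R x :=
      (1 - ⟨PowerSeries.X, X_mem_absConvergent R x⟩) ^ m * ⟨F, hx⟩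
    have hG : evalHom R x G = (1 - x) ^ m * f x := by simp [G, evalHom_X, hfx]
    rw [evalEval_map_algebraMap, id, ← hG]
    refine aevalAeval_evalHom_eq_zero x G ?_
    simpa [G, PowerSeries.algebraMap_apply'] using hPF

end GrowthCriterion

section Multiplicities

variable {α β : YoungDiagram}

theorem colLen_eq_zero {j : ℕ} (hj : α.rowLen 0 ≤ j) : α.colLen j = 0 := by
  by_contra h
  exact hj.not_gt (YoungDiagram.mem_iff_lt_rowLen.1 (YoungDiagram.mem_iff_lt_colLen.2
    (Nat.pos_of_ne_zero h)))

theorem ext_colLen (h : ∀ j, α.colLen j = β.colLen j) : α = β := by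
  ext ⟨i, j⟩
  simp only [YoungDiagram.mem_cells, YoungDiagram.mem_iff_lt_colLen, h j]

theorem exists_colLen_eq {h : ℕ → ℕ} (h_anti : Antitone h) {N : ℕ} (hN : h N = 0) :
    ∃ α : YoungDiagram, ∀ j, α.colLen j = h j := by
  have mem_imp {p : ℕ × ℕ} (hp : p.1 < h p.2) :
      p ∈ Finset.range (h 0) ×ˢ Finset.range N := by
    refine Finset.mk_mem_product (Finset.mem_range.2 (hp.trans_le (h_anti p.2.zero_le)))
      (Finset.mem_range.2 ?_)
    by_contra! hNp
    exact absurd (h_anti hNp) (by omega)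
  let α : YoungDiagram :=
    { cells := {p ∈ Finset.range (h 0) ×ˢ Finset.range N | p.1 < h p.2}
      isLowerSet := by
        intro p q hqp hp
        have hp' := (Finset.mem_filter.1 hp).2
        have hq' : q.1 < h q.2 := hqp.1.trans_lt (hp'.trans_le (h_anti hqp.2))
        exact Finset.mem_filter.2 ⟨mem_imp hq', hq'⟩ }
  have mem_α (i j : ℕ) : (i, j) ∈ α ↔ i < h j :=
    Finset.mem_filter.trans (and_iff_right_of_imp mem_imp)
  exact ⟨α, fun j ↦ eq_of_forall_lt_iff fun i ↦ by
    rw [← YoungDiagram.mem_iff_lt_colLen, mem_α]⟩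

/-- The multiplicities of the part sizes of a partition. Sizes are counted from `0`:
`partMult α s` is the number of parts of `α` equal to `s + 1`. -/
noncomputable def partMult (α : YoungDiagram) : ℕ →₀ ℕ :=
  .onFinset (Finset.range (α.rowLen 0)) (fun s ↦ α.colLen s - α.colLen (s + 1)) fun s hs ↦ by
    contrapose! hs
    rw [colLen_eq_zero (by simpa using hs), Nat.zero_sub]

theorem partMult_eq_sub (α : YoungDiagram) (s : ℕ) :
    partMult α s = α.colLen s - α.colLen (s + 1) := rfl

theorem colLen_eq_sum_Ico_add (α : YoungDiagram) {a b : ℕ} (hab : a ≤ b) :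
    α.colLen a = ∑ s ∈ Finset.Ico a b, partMult α s + α.colLen b := by
  induction b, hab using Nat.le_induction with
  | base => simp
  | succ b hab ih =>
    have hb : partMult α b + α.colLen (b + 1) = α.colLen b :=
      Nat.sub_add_cancel (α.colLen_anti b (b + 1) b.le_succ)
    rw [Finset.sum_Ico_succ_top hab, add_assoc, hb, ih]

theorem colLen_eq_sum_Ico (α : YoungDiagram) (a : ℕ) {b : ℕ} (hb : α.rowLen 0 ≤ b) :
    α.colLen a = ∑ s ∈ Finset.Ico a b, partMult α s := by
  obtain hab | hba := le_total a b
  · rw [colLen_eq_sum_Ico_add α hab, colLen_eq_zero hb, add_zero]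
  · rw [colLen_eq_zero (hb.trans hba), Finset.Ico_eq_empty_of_le hba, Finset.sum_empty]

theorem partMult_bijective : Function.Bijective partMult := by
  refine ⟨fun α β h ↦ ext_colLen fun j ↦ ?_, fun f ↦ ?_⟩
  · rw [colLen_eq_sum_Ico α j (le_max_left _ (β.rowLen 0)), h,
      ← colLen_eq_sum_Ico β j (le_max_right _ _)]
  · obtain ⟨N, hN⟩ := f.support.exists_nat_subset_range
    obtain ⟨α, hα⟩ := exists_colLen_eq (h := fun j ↦ ∑ s ∈ Finset.Ico j N, f s)
      (fun i j hij ↦ Finset.sum_le_sum_of_subset (Finset.Ico_subset_Ico_left hij))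
      (N := N) (by simp)
    refine ⟨α, Finsupp.ext fun s ↦ ?_⟩
    rw [partMult_eq_sub]
    obtain hs | hs := lt_or_ge s N
    · rw [hα, hα, Finset.sum_eq_sum_Ico_succ_bot hs, Nat.add_sub_cancel]
    · have hfs : s ∉ f.support := fun h ↦ hs.not_gt (Finset.mem_range.1 (hN h))
      rw [hα, Finset.Ico_eq_empty_of_le hs, Finset.sum_empty, Nat.zero_sub,
        Finsupp.notMem_support_iff.1 hfs]

theorem card_eq_weight_partMult (α : YoungDiagram) :
    α.card = Finsupp.weight (· + 1) (partMult α) := by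
  set N := α.rowLen 0
  have support_subset : (partMult α).support ⊆ Finset.range N := Finsupp.support_onFinset_subset
  have col_lt {p : ℕ × ℕ} (hp : p ∈ α.cells) : p.2 ∈ Finset.range N :=
    Finset.mem_range.2 ((YoungDiagram.mem_iff_lt_rowLen.1 hp).trans_le
      (α.rowLen_anti 0 p.1 p.1.zero_le))
  calc α.card = ∑ j ∈ Finset.range N, α.colLen j := by
        simp only [YoungDiagram.colLen_eq_card, YoungDiagram.col]
        exact Finset.card_eq_sum_card_fiberwise fun _ ↦ col_lt
    _ = ∑ j ∈ Finset.range N, ∑ s ∈ Finset.Ico j N, partMult α s :=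
        Finset.sum_congr rfl fun j _ ↦ colLen_eq_sum_Ico α j le_rfl
    _ = ∑ s ∈ Finset.range N, ∑ _j ∈ Finset.range (s + 1), partMult α s := by
        simp only [Finset.range_eq_Ico]
        exact Finset.sum_Ico_Ico_comm 0 N _
    _ = Finsupp.weight (· + 1) (partMult α) := by
        rw [Finsupp.weight_apply, Finsupp.sum_of_support_subset _ support_subset _ (by simp)]
        simp [mul_comm]

/-- A partition is determined by the multiplicities of its part sizes, which are arbitrary. -/
noncomputable def partMultEquiv : YoungDiagram ≃ (ℕ →₀ ℕ) := .ofBijective _ partMult_bijective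

end Multiplicities

section Containment

variable {α μ : YoungDiagram}

theorem exists_strictMono_forall_lt_card_mem (s : Finset ℕ) :
    ∃ c : ℕ → ℕ, StrictMono c ∧ ∀ j < s.card, c j ∈ s := by
  refine ⟨fun j ↦ if hj : j < s.card then s.orderEmbOfFin rfl ⟨j, hj⟩ else s.sup id + 1 + j,
    fun i j hij ↦ ?_, fun j hj ↦ by simp [hj]⟩
  have le_sup (k : Fin s.card) : s.orderEmbOfFin rfl k ≤ s.sup id :=
    Finset.le_sup (f := id) (Finset.orderEmbOfFin_mem s rfl k)
  dsimp only
  split_ifs with hi hj hj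
  · simpa using hij
  · linarith [le_sup ⟨i, hi⟩]
  · omega
  · omega

theorem contains_of_rowLen_le_card_support (hμ : IsStrict μ)
    (h : μ.rowLen 0 ≤ (partMult α).support.card) : Contains α μ := by
  obtain ⟨c, c_mono, c_mem⟩ := exists_strictMono_forall_lt_card_mem (partMult α).support
  have rowLen_le (i : ℕ) : μ.rowLen i ≤ (partMult α).support.card :=
    (μ.rowLen_anti 0 i i.zero_le).trans h
  have colLen_le {a b : ℕ} (hab : a ≤ b) : α.colLen (c b) ≤ α.colLen (c a) :=
    α.colLen_anti _ _ (c_mono.monotone hab)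
  have colLen_lt {a b : ℕ} (hab : a < b) (hb : b ≤ (partMult α).support.card) :
      α.colLen (c b) < α.colLen (c a) := by
    have hca := Finsupp.mem_support_iff.1 (c_mem a (hab.trans_le hb))
    rw [partMult_eq_sub, Nat.sub_ne_zero_iff_lt] at hca
    exact (α.colLen_anti _ _ (c_mono hab)).trans_lt hca
  -- Row `i` becomes the topmost row of `α` too short to reach column `c (μ.rowLen i)`; the summand
  -- `i - μ.colLen 0` keeps the map strictly increasing beyond the last row of `μ`.
  refine ⟨fun i ↦ α.colLen (c (μ.rowLen i)) + (i - μ.colLen 0), c,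
    strictMono_nat_of_lt_succ fun i ↦ ?_, c_mono, fun i j ↦ ?_⟩
  · obtain hi | hi := (μ.rowLen_anti i (i + 1) i.le_succ).lt_or_eq
    · have := colLen_lt hi (rowLen_le i)
      omega
    · have rowLen_eq_zero : μ.rowLen i = 0 := by
        by_contra h0
        exact absurd (hμ i (i + 1) (Nat.pos_of_ne_zero h0) hi.symm) (by omega)
      have colLen_le_i : μ.colLen 0 ≤ i := by
        rw [← not_lt, ← YoungDiagram.mem_iff_lt_colLen, YoungDiagram.mem_iff_lt_rowLen]
        omega
      rw [hi]
      omega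
  · rw [YoungDiagram.mem_iff_lt_rowLen, YoungDiagram.mem_iff_lt_colLen]
    dsimp only
    obtain hj | hj := lt_or_ge j (μ.rowLen i)
    · have i_lt : i < μ.colLen 0 := by
        rw [← YoungDiagram.mem_iff_lt_colLen, YoungDiagram.mem_iff_lt_rowLen]
        omega
      have := colLen_lt hj (rowLen_le i)
      omega
    · have := colLen_le hj
      omega

theorem exists_partMult_ne_zero_of_colLen_lt {a b : ℕ} (h : α.colLen b < α.colLen a) :
    ∃ s ∈ Finset.Ico a b, partMult α s ≠ 0 := by
  have hab : a ≤ b := le_of_not_ge fun hba ↦ h.not_ge (α.colLen_anti b a hba)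
  refine Finset.exists_ne_zero_of_sum_ne_zero fun h0 ↦ h.ne' ?_
  rw [colLen_eq_sum_Ico_add α hab, h0, zero_add]

theorem exists_two_partMult_ne_zero_of_contains {n : ℕ} (h0 : n + 1 < μ.rowLen 0)
    (h1 : μ.rowLen 1 = n + 1) (h : Contains α μ) :
    ∃ s t, n ≤ s ∧ s < t ∧ partMult α s ≠ 0 ∧ partMult α t ≠ 0 := by
  obtain ⟨r, c, -, c_mono, mem_iff⟩ := h
  replace mem_iff (i j : ℕ) : j < μ.rowLen i ↔ r i < α.colLen (c j) := by
    rw [← YoungDiagram.mem_iff_lt_rowLen, ← YoungDiagram.mem_iff_lt_colLen, mem_iff]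
  have c_succ_pos : r 0 < α.colLen (c (n + 1)) := (mem_iff 0 (n + 1)).1 (by omega)
  have c_lt : r 1 < α.colLen (c n) := (mem_iff 1 n).1 (by omega)
  have c_succ_le : ¬ r 1 < α.colLen (c (n + 1)) := (mem_iff 1 (n + 1)).not.1 (by omega)
  obtain ⟨s, hs, hs0⟩ := exists_partMult_ne_zero_of_colLen_lt
    ((not_lt.1 c_succ_le).trans_lt c_lt)
  obtain ⟨t, ht, ht0⟩ := exists_partMult_ne_zero_of_colLen_lt (α := α) (a := c (n + 1))
    (b := α.rowLen 0) (by rw [colLen_eq_zero le_rfl]; omega)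
  rw [Finset.mem_Ico] at hs ht
  exact ⟨s, t, c_mono.le_apply.trans hs.1, hs.2.trans_le ht.1, hs0, ht0⟩

end Containment

section GeneratingSums

open scoped ENNReal
open Finsupp

variable {ι : Type*} (w : ι → ℕ) (q : ℝ≥0∞)

theorem card_support_single_add_le {M : Type*} [AddZeroClass M] (i : ι) (k : M) (f : ι →₀ M) :
    (single i k + f).support.card ≤ f.support.card + 1 := by
  classical
  calc (single i k + f).support.card ≤ ((single i k).support ∪ f.support).card :=
        Finset.card_le_card support_add
    _ ≤ (single i k).support.card + f.support.card := Finset.card_union_le _ _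
    _ ≤ f.support.card + 1 := by
        rw [add_comm]
        gcongr
        exact Finset.card_le_card support_single_subset

theorem exists_single_add_eq_of_card_support_eq {f : ι →₀ ℕ} {m : ℕ}
    (hf : f.support.card = m + 1) :
    ∃ i k, ∃ g : ι →₀ ℕ, g.support.card = m ∧ single i (k + 1) + g = f := by
  classical
  obtain ⟨i, hi⟩ : f.support.Nonempty := Finset.card_pos.1 (by omega)
  refine ⟨i, f i - 1, f.erase i, ?_, ?_⟩
  · rw [support_erase, Finset.card_erase_of_mem hi, hf, Nat.add_sub_cancel]
  · rw [Nat.sub_one_add_one (mem_support_iff.1 hi), single_add_erase]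

theorem tsum_pow_weight_card_support_le (m : ℕ) :
    ∑' f : {f : ι →₀ ℕ | f.support.card ≤ m}, q ^ weight w f.1 ≤
      (1 + ∑' p : ι × ℕ, q ^ (w p.1 * (p.2 + 1))) ^ m := by
  induction m with
  | zero =>
    have : {f : ι →₀ ℕ | f.support.card ≤ 0} = {0} := by ext; simp
    rw [this, tsum_singleton (f := fun f : ι →₀ ℕ ↦ q ^ weight w f)]
    simp
  | succ m ih =>
    let S : Set (ι →₀ ℕ) := {f | f.support.card ≤ m}
    let insertSize : S ⊕ (ι × ℕ) × S → {f : ι →₀ ℕ | f.support.card ≤ m + 1} :=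
      Sum.elim (fun f ↦ ⟨f, Nat.le_succ_of_le f.2⟩) fun x ↦
        ⟨single x.1.1 (x.1.2 + 1) + x.2.1,
          (card_support_single_add_le _ _ _).trans (Nat.succ_le_succ x.2.2)⟩
    have insertSize_surjective : Function.Surjective insertSize := by
      rintro ⟨f, hf⟩
      obtain hf' | hf' := Nat.le_or_eq_of_le_succ hf
      · exact ⟨.inl ⟨f, hf'⟩, rfl⟩
      · obtain ⟨i, k, g, hg, rfl⟩ := exists_single_add_eq_of_card_support_eq hf'
        exact ⟨.inr ⟨(i, k), g, hg.le⟩, rfl⟩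
    calc _ ≤ ∑' x, q ^ weight w (insertSize x).1 :=
          ENNReal.tsum_le_tsum_comp_of_surjective insertSize_surjective fun f ↦ q ^ weight w f.1
      _ = (1 + ∑' p : ι × ℕ, q ^ (w p.1 * (p.2 + 1))) * ∑' f : S, q ^ weight w f.1 := by
          rw [ENNReal.summable.tsum_sum ENNReal.summable, add_mul, one_mul, ENNReal.tsum_prod',
            ← ENNReal.tsum_mul_right]
          simp [insertSize, -single_add, weight_single, pow_add, ENNReal.tsum_mul_left,
            mul_comm (w _)]
      _ ≤ _ := by
          rw [pow_succ']
          gcongr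

theorem inv_one_sub_mul_tsum_pow_weight_le {i : ι} {S T : Set (ι →₀ ℕ)} (hS : ∀ f ∈ S, f i = 0)
    (hST : ∀ f ∈ S, ∀ k, single i k + f ∈ T) :
    (1 - q ^ w i)⁻¹ * ∑' f : S, q ^ weight w f.1 ≤ ∑' f : T, q ^ weight w f.1 := by
  let addParts (x : ℕ × S) : T := ⟨single i x.1 + x.2.1, hST _ x.2.2 _⟩
  have addParts_injective : Function.Injective addParts := by
    rintro ⟨k, f, hf⟩ ⟨l, g, hg⟩ h
    have hfg : single i k + f = single i l + g := congr($h.1)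
    obtain rfl : k = l := by simpa [hS f hf, hS g hg] using congr($hfg i)
    simpa using hfg
  calc (1 - q ^ w i)⁻¹ * ∑' f : S, q ^ weight w f.1
      = ∑' x, q ^ weight w (addParts x).1 := by
        rw [ENNReal.tsum_prod', ← ENNReal.tsum_geometric, ← ENNReal.tsum_mul_right]
        simp [addParts, weight_single, pow_add, ENNReal.tsum_mul_left, mul_comm _ (w _), pow_mul]
    _ ≤ ∑' f : T, q ^ weight w f.1 :=
        ENNReal.tsum_comp_le_tsum_of_injective addParts_injective fun f ↦ q ^ weight w f.1

/-- The tail `∑_{s > n} qˢ / (1 - qˢ)` of the Lambert series of the divisor function, expanded into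
a double sum over the sizes `s = n + p.1 + 1` and the multiplicities `p.2 + 1`. -/
noncomputable def lambertTail (n : ℕ) (q : ℝ≥0∞) : ℝ≥0∞ :=
  ∑' p : ℕ × ℕ, q ^ ((n + p.1 + 1) * (p.2 + 1))

theorem prod_inv_one_sub_mul_lambertTail_le {n j : ℕ} (hj : j ≤ n) :
    (∏ i ∈ Finset.range j, (1 - q ^ (i + 1))⁻¹) * lambertTail n q ≤
      ∑' f : {f : ℕ →₀ ℕ | ∃ s ≥ n, ∀ i ≥ j, f i ≠ 0 → i = s}, q ^ weight (· + 1) f.1 := by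
  induction j with
  | zero =>
    let oneSize (p : ℕ × ℕ) : {f : ℕ →₀ ℕ | ∃ s ≥ n, ∀ i ≥ 0, f i ≠ 0 → i = s} :=
      ⟨single (n + p.1) (p.2 + 1), n + p.1, Nat.le_add_right _ _, fun i _ hi ↦ by
        contrapose! hi
        exact single_eq_of_ne hi⟩
    have oneSize_injective : Function.Injective oneSize := by
      rintro ⟨s, k⟩ ⟨t, l⟩ h
      have := (single_eq_single_iff _ _ _ _).1 congr($h.1)
      exact Prod.ext (by omega) (by omega)
    have oneSize_weight (p : ℕ × ℕ) :
        weight (fun i ↦ i + 1) (oneSize p).1 = (n + p.1 + 1) * (p.2 + 1) := by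
      rw [weight_single, smul_eq_mul, mul_comm]
    simpa only [Finset.range_zero, Finset.prod_empty, one_mul, lambertTail, ← oneSize_weight] using
      ENNReal.tsum_comp_le_tsum_of_injective oneSize_injective fun f ↦ q ^ weight (· + 1) f.1
  | succ j ih =>
    rw [Finset.prod_range_succ, mul_comm (∏ _ ∈ _, _), mul_assoc]
    refine (mul_le_mul_right (ih (by omega)) _).trans
      (inv_one_sub_mul_tsum_pow_weight_le (· + 1) q (i := j) ?_ ?_)
    · rintro f ⟨s, hs, hf⟩
      by_contra hfj
      exact absurd (hf j le_rfl hfj) (by omega)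
    · rintro f ⟨s, hs, hf⟩ k
      refine ⟨s, hs, fun i hi hfi ↦ hf i (by omega) ?_⟩
      rwa [Finsupp.add_apply, single_eq_of_ne (by omega), zero_add] at hfi

variable {q} {μ : YoungDiagram}

/-- The value at `q` of the generating function of the partitions that avoid `μ`, as an extended
real, so that divergence is not hidden by a junk value. -/
noncomputable def avoidSum (μ : YoungDiagram) (q : ℝ≥0∞) : ℝ≥0∞ :=
  ∑' n, ((Av n μ).ncard : ℝ≥0∞) * q ^ n

theorem avoidSum_eq_tsum_pow_card (μ : YoungDiagram) (q : ℝ≥0∞) :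
    avoidSum μ q = ∑' α : {α | ¬ Contains α μ}, q ^ α.1.card := by
  rw [← ENNReal.tsum_fiberwise _ fun α : {α | ¬ Contains α μ} ↦ α.1.card]
  refine tsum_congr fun n ↦ ?_
  let fiberEquiv : (fun α : {α | ¬ Contains α μ} ↦ α.1.card) ⁻¹' {n} ≃ Av n μ :=
    { toFun α := ⟨α.1, α.2, α.1.2⟩
      invFun α := ⟨⟨α, α.2.2⟩, α.2.1⟩ }
  have : Finite (Av n μ) := finite_Av n μ
  calc ((Av n μ).ncard : ℝ≥0∞) * q ^ n = ∑' _ : Av n μ, q ^ n := by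
        rw [ENNReal.tsum_const, ENat.card_eq_coe_natCard, Nat.card_coe_set_eq, ENat.toENNReal_coe]
    _ = ∑' α : Av n μ, q ^ α.1.card := tsum_congr fun α ↦ by rw [α.2.1]
    _ = _ := (fiberEquiv.tsum_eq fun α : Av n μ ↦ q ^ α.1.card).symm

theorem avoidSum_le (hμ : IsStrict μ) {m : ℕ} (hm : μ.rowLen 0 = m + 1) (q : ℝ≥0∞) :
    avoidSum μ q ≤ (1 + lambertTail 0 q) ^ m := by
  have card_le (α : {α | ¬ Contains α μ}) : (partMult α.1).support.card ≤ m := by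
    by_contra! h
    exact α.2 (contains_of_rowLen_le_card_support hμ (by omega))
  have partMult_injective : Function.Injective fun α : {α | ¬ Contains α μ} ↦
      (⟨partMult α.1, card_le α⟩ : {f : ℕ →₀ ℕ | f.support.card ≤ m}) := fun α β h ↦
    Subtype.ext (partMult_bijective.injective congr($h.1))
  calc avoidSum μ q = ∑' α : {α | ¬ Contains α μ}, q ^ weight (· + 1) (partMult α.1) := by
        simp only [avoidSum_eq_tsum_pow_card, card_eq_weight_partMult]
    _ ≤ ∑' f : {f : ℕ →₀ ℕ | f.support.card ≤ m}, q ^ weight (· + 1) f.1 :=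
        ENNReal.tsum_comp_le_tsum_of_injective partMult_injective fun f ↦ q ^ weight (· + 1) f.1
    _ ≤ (1 + lambertTail 0 q) ^ m := by
        simpa only [lambertTail, zero_add] using tsum_pow_weight_card_support_le (· + 1) q m

theorem le_avoidSum {n : ℕ} (h0 : n + 1 < μ.rowLen 0) (h1 : μ.rowLen 1 = n + 1) (q : ℝ≥0∞) :
    (∏ i ∈ Finset.range n, (1 - q ^ (i + 1))⁻¹) * lambertTail n q ≤ avoidSum μ q := by
  have partMult_symm (f : ℕ →₀ ℕ) : partMult (partMultEquiv.symm f) = f :=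
    partMultEquiv.apply_symm_apply f
  have not_contains (f : {f : ℕ →₀ ℕ | ∃ s ≥ n, ∀ i ≥ n, f i ≠ 0 → i = s}) :
      ¬ Contains (partMultEquiv.symm f.1) μ := by
    intro h
    obtain ⟨s, -, hs⟩ := f.2
    obtain ⟨i, j, hni, hij, hi, hj⟩ := exists_two_partMult_ne_zero_of_contains h0 h1 h
    rw [partMult_symm] at hi hj
    exact hij.ne ((hs i hni hi).trans (hs j (hni.trans hij.le) hj).symm)
  have symm_injective : Function.Injective
      fun f ↦ (⟨partMultEquiv.symm f.1, not_contains f⟩ : {α | ¬ Contains α μ}) := fun f g h ↦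
    Subtype.ext (partMultEquiv.symm.injective congr($h.1))
  calc _ ≤ _ := prod_inv_one_sub_mul_lambertTail_le q le_rfl
    _ = ∑' f : {f : ℕ →₀ ℕ | ∃ s ≥ n, ∀ i ≥ n, f i ≠ 0 → i = s},
          q ^ (partMultEquiv.symm f.1).card := by
        simp only [card_eq_weight_partMult, partMult_symm]
    _ ≤ ∑' α : {α | ¬ Contains α μ}, q ^ α.1.card :=
        ENNReal.tsum_comp_le_tsum_of_injective symm_injective fun α ↦ q ^ α.1.card
    _ = avoidSum μ q := (avoidSum_eq_tsum_pow_card μ q).symm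

end GeneratingSums

section Asymptotics

open scoped ENNReal NNReal
open Filter Topology

theorem lambertTail_eq_tsum (n : ℕ) (q : ℝ≥0∞) :
    lambertTail n q = ∑' s, q ^ (n + s + 1) * (1 - q ^ (n + s + 1))⁻¹ := by
  rw [lambertTail, ENNReal.tsum_prod']
  simp only [pow_mul, ENNReal.tsum_geometric_add_one]

variable {q : ℝ≥0∞}

theorem one_sub_pow_le_mul_one_sub (hq : q ≤ 1) (k : ℕ) : 1 - q ^ k ≤ k * (1 - q) := by
  rw [tsub_le_iff_right]
  induction k with
  | zero => simp
  | succ k ih =>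
    calc 1 ≤ k * (1 - q) + q ^ k * ((1 - q) + q) := by rwa [tsub_add_cancel_of_le hq, mul_one]
      _ ≤ k * (1 - q) + (1 * (1 - q) + q ^ k * q) := by
          rw [mul_add (q ^ k)]
          gcongr
          exact pow_le_one₀ zero_le hq
      _ = (k + 1 : ℕ) * (1 - q) + q ^ (k + 1) := by
          push_cast
          ring

theorem mul_one_sub_mul_pow_le_one_sub_pow (hq : q ≤ 1) (k : ℕ) :
    k * (1 - q) * q ^ k ≤ 1 - q ^ k := by
  have q_ne_top : q ≠ ⊤ := ne_top_of_le_ne_top ENNReal.one_ne_top hq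
  suffices k * (1 - q) * q ^ k + q ^ k ≤ 1 from
    ENNReal.le_sub_of_add_le_right (ENNReal.pow_ne_top q_ne_top) this
  induction k with
  | zero => simp
  | succ k ih =>
    calc (k + 1 : ℕ) * (1 - q) * q ^ (k + 1) + q ^ (k + 1)
        = (k * (1 - q) * q ^ k + q ^ k) * q + (1 - q) * q ^ (k + 1) := by
          push_cast
          ring
      _ ≤ 1 * q + (1 - q) * 1 := by
          gcongr
          exact pow_le_one₀ zero_le hq
      _ = 1 := by rw [one_mul, mul_one, add_tsub_cancel_of_le hq]

theorem inv_natCast_le_one_sub_mul_inv (hq : q < 1) (k : ℕ) :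
    (k : ℝ≥0∞)⁻¹ ≤ (1 - q) * (1 - q ^ k)⁻¹ := by
  have h0 : 1 - q ≠ 0 := (tsub_pos_of_lt hq).ne'
  have htop : 1 - q ≠ ⊤ := ENNReal.sub_ne_top ENNReal.one_ne_top
  calc (k : ℝ≥0∞)⁻¹ = (1 - q) * (k * (1 - q))⁻¹ := by
        rw [ENNReal.mul_inv (.inr htop) (.inr h0), mul_left_comm, ENNReal.mul_inv_cancel h0 htop,
          mul_one]
    _ ≤ (1 - q) * (1 - q ^ k)⁻¹ := by
        gcongr
        exact one_sub_pow_le_mul_one_sub hq.le k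

theorem tsum_pow_mul_inv_le_one_sub_mul_lambertTail (n : ℕ) (hq : q < 1) :
    ∑' s : ℕ, q ^ (n + s + 1) * ((n + s + 1 : ℕ) : ℝ≥0∞)⁻¹ ≤ (1 - q) * lambertTail n q := by
  rw [lambertTail_eq_tsum, ← ENNReal.tsum_mul_left]
  refine ENNReal.tsum_le_tsum fun s ↦ ?_
  rw [mul_left_comm]
  gcongr
  exact inv_natCast_le_one_sub_mul_inv hq _

-- At the point `q ^ 2`, one factor `q ^ k` pays for `k * (1 - q) * q ^ k ≤ 1 - q ^ k`, and the
-- other one makes the sum over `k` a logarithm series.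
theorem one_sub_mul_sq_pow_mul_inv_le (hq : q ≤ 1) {k : ℕ} (hk : k ≠ 0) :
    (1 - q) * ((q ^ 2) ^ k * (1 - (q ^ 2) ^ k)⁻¹) ≤ q ^ k * (k : ℝ≥0∞)⁻¹ := by
  have sq_le : (q ^ 2) ^ k ≤ q ^ k :=
    pow_le_pow_left₀ zero_le (pow_le_of_le_one zero_le hq two_ne_zero) k
  rw [← mul_assoc, ← div_eq_mul_inv]
  refine ENNReal.div_le_of_le_mul ?_
  calc (1 - q) * (q ^ 2) ^ k = q ^ k * (k : ℝ≥0∞)⁻¹ * (k * (1 - q) * q ^ k) := by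
        rw [mul_assoc, mul_assoc (k : ℝ≥0∞), ENNReal.inv_mul_cancel_left (by simpa) (by simp)]
        ring
    _ ≤ q ^ k * (k : ℝ≥0∞)⁻¹ * (1 - (q ^ 2) ^ k) := by
        gcongr
        exact (mul_one_sub_mul_pow_le_one_sub_pow hq k).trans (tsub_le_tsub_left sq_le 1)

theorem one_sub_sq_mul_lambertTail_zero_le (hq : q ≤ 1) :
    (1 - q ^ 2) * lambertTail 0 (q ^ 2) ≤
      2 * ∑' s : ℕ, q ^ (s + 1) * ((s + 1 : ℕ) : ℝ≥0∞)⁻¹ := by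
  calc (1 - q ^ 2) * lambertTail 0 (q ^ 2) ≤ 2 * (1 - q) * lambertTail 0 (q ^ 2) := by
        gcongr
        exact_mod_cast one_sub_pow_le_mul_one_sub hq 2
    _ ≤ 2 * ∑' s : ℕ, q ^ (s + 1) * ((s + 1 : ℕ) : ℝ≥0∞)⁻¹ := by
        rw [lambertTail_eq_tsum, mul_assoc, ← ENNReal.tsum_mul_left]
        simp only [zero_add]
        gcongr 2 * ?_
        exact ENNReal.tsum_le_tsum fun s ↦ one_sub_mul_sq_pow_mul_inv_le hq s.succ_ne_zero

theorem tsum_ofReal_pow_mul_inv {y : ℝ} (hy0 : 0 ≤ y) (hy1 : y < 1) :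
    ∑' s : ℕ, ENNReal.ofReal y ^ (s + 1) * ((s + 1 : ℕ) : ℝ≥0∞)⁻¹ =
      ENNReal.ofReal (-Real.log (1 - y)) := by
  have hlog := Real.hasSum_pow_div_log_of_abs_lt_one (abs_lt.2 ⟨by linarith, hy1⟩)
  rw [← hlog.tsum_eq, ENNReal.ofReal_tsum_of_nonneg (fun s ↦ by positivity) hlog.summable]
  refine tsum_congr fun s ↦ ?_
  rw [ENNReal.ofReal_div_of_pos (by positivity), ENNReal.ofReal_pow hy0, div_eq_mul_inv]
  norm_cast

theorem one_sub_mul_lambertTail_zero_le_log {x : ℝ} (hx0 : 0 ≤ x) (hx1 : x < 1) :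
    (1 - ENNReal.ofReal x) * lambertTail 0 (ENNReal.ofReal x) ≤
      ENNReal.ofReal (2 * (Real.log 2 - Real.log (1 - x))) := by
  have sqrt_lt : √x < 1 := by rwa [Real.sqrt_lt' one_pos, one_pow]
  have ofReal_sq : ENNReal.ofReal √x ^ 2 = ENNReal.ofReal x := by
    rw [← ENNReal.ofReal_pow x.sqrt_nonneg, Real.sq_sqrt hx0]
  have half_le : (1 - x) / 2 ≤ 1 - √x := by
    nlinarith [Real.sq_sqrt hx0, x.sqrt_nonneg]
  have log_le : Real.log (1 - x) - Real.log 2 ≤ Real.log (1 - √x) := by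
    rw [← Real.log_div (sub_pos.2 hx1).ne' two_ne_zero]
    exact Real.log_le_log (half_pos (sub_pos.2 hx1)) half_le
  calc _ = (1 - ENNReal.ofReal √x ^ 2) * lambertTail 0 (ENNReal.ofReal √x ^ 2) := by rw [ofReal_sq]
    _ ≤ 2 * ENNReal.ofReal (-Real.log (1 - √x)) := by
        rw [← tsum_ofReal_pow_mul_inv x.sqrt_nonneg sqrt_lt]
        exact one_sub_sq_mul_lambertTail_zero_le (ENNReal.ofReal_le_one.2 sqrt_lt.le)
    _ ≤ ENNReal.ofReal (2 * (Real.log 2 - Real.log (1 - x))) := by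
        rw [ENNReal.ofReal_mul zero_le_two, ENNReal.ofReal_ofNat]
        gcongr
        linarith

theorem tendsto_tsum_pow_mul_inv_nhds_top (n : ℕ) :
    Tendsto (fun q : ℝ≥0∞ ↦ ∑' s : ℕ, q ^ (n + s + 1) * ((n + s + 1 : ℕ) : ℝ≥0∞)⁻¹)
      (𝓝 1) (𝓝 ⊤) := by
  have lower_semicontinuous : LowerSemicontinuous fun q : ℝ≥0∞ ↦
      ∑' s : ℕ, q ^ (n + s + 1) * ((n + s + 1 : ℕ) : ℝ≥0∞)⁻¹ :=
    lowerSemicontinuous_tsum fun s ↦ ((ENNReal.continuous_mul_const (by simp)).comp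
      (ENNReal.continuous_pow _)).lowerSemicontinuous
  have harmonic : ∑' s : ℕ, ((n + s + 1 : ℕ) : ℝ≥0∞)⁻¹ = ⊤ := by
    have not_summable : ¬ Summable fun k : ℕ ↦ (k : ℝ≥0)⁻¹ := by
      simpa only [← NNReal.summable_coe, NNReal.coe_inv, NNReal.coe_natCast] using
        Real.not_summable_natCast_inv
    rw [← NNReal.summable_nat_add_iff (n + 1), ← ENNReal.tsum_coe_ne_top_iff_summable,
      not_not] at not_summable
    rw [← not_summable]
    refine tsum_congr fun s ↦ ?_
    rw [ENNReal.coe_inv (by positivity), ENNReal.coe_natCast, add_assoc, add_left_comm]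
  refine tendsto_order.2 ⟨fun a ha ↦ lower_semicontinuous 1 a ?_, fun a ha ↦ absurd ha not_top_lt⟩
  simpa only [one_pow, one_mul, harmonic] using ha

variable {μ : YoungDiagram}

theorem one_sub_pow_mul_avoidSum_le (hμ : IsStrict μ) {m : ℕ} (hm : μ.rowLen 0 = m + 1) {x : ℝ}
    (hx0 : 0 ≤ x) (hx1 : x < 1) :
    (1 - ENNReal.ofReal x) ^ m * avoidSum μ (ENNReal.ofReal x) ≤
      ENNReal.ofReal ((1 + 2 * (Real.log 2 - Real.log (1 - x))) ^ m) := by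
  have log_le : Real.log (1 - x) ≤ Real.log 2 := Real.log_le_log (by linarith) (by linarith)
  calc _ ≤ ((1 - ENNReal.ofReal x) * (1 + lambertTail 0 (ENNReal.ofReal x))) ^ m := by
        rw [mul_pow]
        gcongr
        exact avoidSum_le hμ hm _
    _ ≤ (1 + ENNReal.ofReal (2 * (Real.log 2 - Real.log (1 - x)))) ^ m := by
        rw [mul_add, mul_one]
        gcongr
        · exact tsub_le_self
        · exact one_sub_mul_lambertTail_zero_le_log hx0 hx1
    _ = _ := by
        rw [← ENNReal.ofReal_one, ← ENNReal.ofReal_add zero_le_one (by linarith),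
          ENNReal.ofReal_pow (by linarith)]

theorem avoidSum_ne_top (hμ : IsStrict μ) (hpos : 0 < μ.rowLen 0) {x : ℝ} (hx0 : 0 ≤ x)
    (hx1 : x < 1) : avoidSum μ (ENNReal.ofReal x) ≠ ⊤ := by
  obtain ⟨m, hm⟩ := Nat.exists_eq_add_one.2 hpos
  have one_sub_pow_ne_zero : (1 - ENNReal.ofReal x) ^ m ≠ 0 :=
    pow_ne_zero _ (tsub_pos_of_lt (ENNReal.ofReal_lt_one.2 hx1)).ne'
  exact (ENNReal.lt_top_of_mul_ne_top_right (ne_top_of_le_ne_top ENNReal.ofReal_ne_top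
    (one_sub_pow_mul_avoidSum_le hμ hm hx0 hx1)) one_sub_pow_ne_zero).ne

theorem tendsto_one_sub_pow_mul_avoidSum {n : ℕ} (h0 : n + 1 < μ.rowLen 0)
    (h1 : μ.rowLen 1 = n + 1) :
    Tendsto (fun q ↦ (1 - q) ^ (n + 1) * avoidSum μ q) (𝓝[<] 1) (𝓝 ⊤) := by
  let c : ℝ≥0∞ := ∏ i ∈ Finset.range n, ((i + 1 : ℕ) : ℝ≥0∞)⁻¹
  have c_ne_zero : c ≠ 0 :=
    Finset.prod_ne_zero_iff.2 fun i _ ↦ ENNReal.inv_ne_zero.2 (ENNReal.natCast_ne_top _)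
  have lower := ENNReal.Tendsto.const_mul (a := c)
    ((tendsto_tsum_pow_mul_inv_nhds_top n).mono_left (nhdsWithin_le_nhds (s := Set.Iio 1)))
    (.inl ENNReal.top_ne_zero)
  rw [ENNReal.mul_top c_ne_zero] at lower
  refine tendsto_nhds_top_mono lower ?_
  filter_upwards [self_mem_nhdsWithin] with q (hq : q < 1)
  calc _ ≤ (∏ i ∈ Finset.range n, (1 - q) * (1 - q ^ (i + 1))⁻¹) * ((1 - q) * lambertTail n q) := by
        gcongr ?_ * ?_
        · exact Finset.prod_le_prod' fun i _ ↦ inv_natCast_le_one_sub_mul_inv hq _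
        · exact tsum_pow_mul_inv_le_one_sub_mul_lambertTail n hq
    _ = (1 - q) ^ (n + 1) *
        ((∏ i ∈ Finset.range n, (1 - q ^ (i + 1))⁻¹) * lambertTail n q) := by
        rw [Finset.prod_mul_distrib, Finset.prod_const, Finset.card_range]
        ring
    _ ≤ (1 - q) ^ (n + 1) * avoidSum μ q := by
        gcongr
        exact le_avoidSum h0 h1 q

theorem exists_evalHom_genFun_eq {x : ℝ} (hx : 0 ≤ x)
    (hμx : avoidSum μ (ENNReal.ofReal x) ≠ ⊤) :
    ∃ h : genFun μ ∈ absConvergent ℚ x,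
      evalHom ℚ x ⟨genFun μ, h⟩ = (avoidSum μ (ENNReal.ofReal x)).toReal := by
  have coeff_smul (n : ℕ) : PowerSeries.coeff n (genFun μ) • x ^ n =
      (((Av n μ).ncard : ℝ≥0∞) * ENNReal.ofReal x ^ n).toReal := by
    simp [genFun, ENNReal.toReal_ofReal hx, Rat.smul_def]
  have summable := ENNReal.summable_toReal hμx
  refine ⟨?_, ?_⟩
  · simpa only [mem_absConvergent, coeff_smul] using summable.norm
  · rw [evalHom_apply, avoidSum, ENNReal.tsum_toReal_eq (ENNReal.ne_top_of_tsum_ne_top hμx)]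
    exact tsum_congr coeff_smul

theorem toReal_one_sub_pow_mul_avoidSum {x : ℝ} (hx0 : 0 ≤ x) (hx1 : x ≤ 1) (m : ℕ) :
    ((1 - ENNReal.ofReal x) ^ m * avoidSum μ (ENNReal.ofReal x)).toReal =
      (1 - x) ^ m * (avoidSum μ (ENNReal.ofReal x)).toReal := by
  rw [ENNReal.toReal_mul, ENNReal.toReal_pow, ← ENNReal.ofReal_one, ← ENNReal.ofReal_sub 1 hx0,
    ENNReal.toReal_ofReal (sub_nonneg.2 hx1)]

theorem one_sub_pow_mul_toReal_avoidSum_le (hμ : IsStrict μ) {m : ℕ} (hm : μ.rowLen 0 = m + 1)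
    {x : ℝ} (hx0 : 0 ≤ x) (hx1 : x < 1) :
    (1 - x) ^ m * (avoidSum μ (ENNReal.ofReal x)).toReal ≤
      (1 + 2 * (Real.log 2 - Real.log (1 - x))) ^ m := by
  have log_le : Real.log (1 - x) ≤ Real.log 2 := Real.log_le_log (by linarith) (by linarith)
  rw [← toReal_one_sub_pow_mul_avoidSum hx0 hx1.le]
  exact ENNReal.toReal_le_of_le_ofReal (pow_nonneg (by linarith) m)
    (one_sub_pow_mul_avoidSum_le hμ hm hx0 hx1)

theorem tendsto_one_sub_pow_mul_toReal_avoidSum (hμ : IsStrict μ) {n : ℕ}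
    (h0 : n + 1 < μ.rowLen 0) (h1 : μ.rowLen 1 = n + 1) :
    Tendsto (fun x : ℝ ↦ (1 - x) ^ (n + 1) * (avoidSum μ (ENNReal.ofReal x)).toReal)
      (𝓝[<] 1) atTop := by
  have ofReal_tendsto : Tendsto ENNReal.ofReal (𝓝[<] 1) (𝓝[<] 1) := by
    refine tendsto_nhdsWithin_iff.2 ⟨?_, ?_⟩
    · simpa using (ENNReal.continuous_ofReal.tendsto 1).mono_left nhdsWithin_le_nhds
    · filter_upwards [self_mem_nhdsWithin] with x hx using ENNReal.ofReal_lt_one.2 hx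
  refine ENNReal.tendsto_ofReal_nhds_top.1
    (((tendsto_one_sub_pow_mul_avoidSum h0 h1).comp ofReal_tendsto).congr' ?_)
  filter_upwards [Ioo_mem_nhdsLT one_pos] with x ⟨hx0, hx1⟩
  rw [← toReal_one_sub_pow_mul_avoidSum hx0.le hx1.le, ENNReal.ofReal_toReal, Function.comp_apply]
  exact ENNReal.mul_ne_top (ENNReal.pow_ne_top (ENNReal.sub_ne_top ENNReal.one_ne_top))
    (avoidSum_ne_top hμ (by omega) hx0.le hx1)

end Asymptotics

end PartitionPattern

open PartitionPattern Polynomial Topology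

/-- `IsAlgebraic (Polynomial ℚ) F` says that `P(z, F(z)) = 0` for some nonzero polynomial `P` in
two variables over `ℚ`, i.e. that `F` is algebraic over `ℚ(z)`. -/
theorem corollary4p10 (μ : YoungDiagram) (hstrict : PartitionPattern.IsStrict μ)
    (hdiff : μ.rowLen 0 = μ.rowLen 1 + 1) (hpos : 0 < μ.rowLen 1) :
    ¬ IsAlgebraic (Polynomial ℚ) (PartitionPattern.genFun μ) := by
  obtain ⟨n, hn⟩ := Nat.exists_eq_add_one.2 hpos
  have hx : ∀ᶠ x in 𝓝[<] (1 : ℝ), 0 < x ∧ x < 1 := Ioo_mem_nhdsLT one_pos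
  refine transcendental_of_tendsto_atTop_of_le_log
    (p := (C (1 + 2 * Real.log 2) + C 2 * X) ^ (n + 1)) ?_
    (tendsto_one_sub_pow_mul_toReal_avoidSum hstrict (by omega) hn) ?_
  · filter_upwards [hx] with x ⟨hx0, hx1⟩
    exact exists_evalHom_genFun_eq hx0.le (avoidSum_ne_top hstrict (by omega) hx0.le hx1)
  · filter_upwards [hx] with x ⟨hx0, hx1⟩
    refine (one_sub_pow_mul_toReal_avoidSum_le hstrict (by omega) hx0.le hx1).trans_eq ?_
    simp only [eval_pow, eval_add, eval_mul, eval_C, eval_X]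
    ring
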